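/- Let $C\in\mathbb{R}^{n\times n}$ be symmetric positive semidefinite, let $s$ be an integer with $0<s<n$ and $s\le \operatorname{rank}(C)$, and let $A\in\mathbb{R}^{m\times n}$, $b\in\mathbb{R}^m$. Write $\operatorname{ldet}$ for the natural logarithm of the determinant, with $\operatorname{ldet} M=-\infty$ if $\det M=0$; $\mathbf{e}$ for the all-ones vector; $\circ$ for the entrywise product; $\operatorname{Diag}(x)$ for the diagonal matrix with diagonal $x$ and $\operatorname{diag}(X)$ for the diagonal of $X$; and let a maximum over the empty set be $-\infty$. Let $$z:=\max\{\operatorname{ldet} C[S(x),S(x)] : \mathbf{e}^\top x=s,\ x\in\{0,1\}^n,\ Ax\le b\},$$ where $S(x)$ is the support of $x$ and $C[S,S]$ is the principal submatrix of $C$ indexed by $S$. Let $$P(n,s):=\{(x,X) : x\in\mathbb{R}^n,\ X\in\mathbb{R}^{n\times n}\text{ symmetric},\ X-xx^\top\succeq 0,\ \operatorname{diag}(X)=x,\ \mathbf{e}^\top x=s,\ X\mathbf{e}=sx\}.$$ For $\Upsilon=(\gamma_1,\dots,\gamma_n)^\top$ with all $\gamma_i>0$, let $$f(x,X;\Upsilon):=\operatorname{ldet}\big((\operatorname{Diag}(\Upsilon)\,C\operatorname{Diag}(\Upsilon))\circ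 X+\operatorname{Diag}(\mathbf{e}-x)\big)-2\sum_{i=1}^n x_i\log\gamma_i$$ and $$z_{\mathrm{BQP}}(\Upsilon):=\max\{f(x,X;\Upsilon) : (x,X)\in P(n,s),\ Ax\le b\}.$$ Whenever the feasible region $\{(x,X)\in P(n,s) : Ax\le b\}$ is non-empty, this maximum is attained, and: (i) $z\le z_{\mathrm{BQP}}(\Upsilon)$ for every $\Upsilon\in\mathbb{R}^n_{++}$; (ii) for every $\Upsilon\in\mathbb{R}^n_{++}$, the feasible region is convex and $f(\cdot,\cdot;\Upsilon)$ is concave on it, as a function with values in $[-\infty,\infty)$; (iii) $z_{\mathrm{BQP}}(\Upsilon)$ is a convex function of $\log\Upsilon:=(\log\gamma_1,\dots,\log\gamma_n)^\top\in\mathbb{R}^n$, with values in $[-\infty,\infty)$. If the feasible region is empty, (i)-(iii) hold trivially. -/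

import Mathlib

open scoped Matrix

noncomputable section

/-- `ldet M`: the natural logarithm of the determinant, as an extended real number, equal to `-∞`
when the determinant is not positive (all matrices it is used for below are positive semidefinite,
so this only happens when the determinant is `0`). -/
def ldet {ι : Type*} [Fintype ι] [DecidableEq ι] (M : Matrix ι ι ℝ) : EReal :=
  if 0 < M.det then ((Real.log M.det : ℝ) : EReal) else ⊥

/-- The support `S(x)` of a vector `x`. -/
def supp {n : ℕ} (x : Fin n → ℝ) : Finset (Fin n) :=
  Finset.univ.filter (fun i => x i ≠ 0)

/-- The principal submatrix `C[S,S]`. -/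
def principalSubmatrix {n : ℕ} (C : Matrix (Fin n) (Fin n) ℝ) (S : Finset (Fin n)) :
    Matrix S S ℝ :=
  C.submatrix (fun i => (i : Fin n)) (fun i => (i : Fin n))

/-- Feasible set of the constrained maximum-entropy sampling problem:
`eᵀx = s`, `x ∈ {0,1}ⁿ`, `Ax ≤ b`. -/
def cmespFeasible {m n : ℕ} (s : ℕ) (A : Matrix (Fin m) (Fin n) ℝ) (b : Fin m → ℝ) :
    Set (Fin n → ℝ) :=
  {x | ∑ i, x i = (s : ℝ) ∧ (∀ i, x i = 0 ∨ x i = 1) ∧ A *ᵥ x ≤ b}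

/-- The optimal value `z` of the constrained maximum-entropy sampling problem. It is the maximum
over a finite set, with value `-∞` if that set is empty. -/
def cmespValue {m n : ℕ} (C : Matrix (Fin n) (Fin n) ℝ) (s : ℕ)
    (A : Matrix (Fin m) (Fin n) ℝ) (b : Fin m → ℝ) : EReal :=
  sSup ((fun x => ldet (principalSubmatrix C (supp x))) '' cmespFeasible s A b)

/-- The set `P(n,s)` of pairs `(x,X)`, `X` symmetric, with `X - xxᵀ ⪰ 0`, `diag X = x`,
`eᵀx = s`, `Xe = sx`. These constraints force `x ∈ [0,1]ⁿ` and `X ⪰ 0`. -/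
def bqpP (n s : ℕ) : Set ((Fin n → ℝ) × Matrix (Fin n) (Fin n) ℝ) :=
  {p | p.2.IsSymm ∧ (p.2 - Matrix.vecMulVec p.1 p.1).PosSemidef ∧ p.2.diag = p.1 ∧
    ∑ i, p.1 i = (s : ℝ) ∧ p.2 *ᵥ (fun _ => 1) = (s : ℝ) • p.1}

/-- The feasible region of the BQP relaxation: `(x,X) ∈ P(n,s)`, `Ax ≤ b`. -/
def bqpFeasible {m n : ℕ} (s : ℕ) (A : Matrix (Fin m) (Fin n) ℝ) (b : Fin m → ℝ) :
    Set ((Fin n → ℝ) × Matrix (Fin n) (Fin n) ℝ) :=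
  {p | p ∈ bqpP n s ∧ A *ᵥ p.1 ≤ b}

/-- The BQP objective with scaling vector `γ`:
`ldet ((Diag γ C Diag γ) ∘ X + Diag (e - x)) - 2 ∑ xᵢ log γᵢ`. -/
def bqpObjective {n : ℕ} (C : Matrix (Fin n) (Fin n) ℝ) (γ : Fin n → ℝ)
    (p : (Fin n → ℝ) × Matrix (Fin n) (Fin n) ℝ) : EReal :=
  ldet (Matrix.hadamard (Matrix.diagonal γ * C * Matrix.diagonal γ) p.2
      + Matrix.diagonal (fun i => 1 - p.1 i))
    - ((2 * ∑ i, p.1 i * Real.log (γ i) : ℝ) : EReal)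

/-- The g-scaled BQP bound: the maximum of the objective over the feasible region, with value `-∞`
if that region is empty. -/
def bqpBound {m n : ℕ} (C : Matrix (Fin n) (Fin n) ℝ) (s : ℕ)
    (A : Matrix (Fin m) (Fin n) ℝ) (b : Fin m → ℝ) (γ : Fin n → ℝ) : EReal :=
  sSup (bqpObjective C γ '' bqpFeasible s A b)

/-- Concavity on a set of an extended-real-valued function (used for values in `[-∞, ∞)`). -/
def ERealConcaveOn {E : Type*} [AddCommGroup E] [Module ℝ E] (S : Set E) (f : E → EReal) : Prop :=
  Convex ℝ S ∧ ∀ x ∈ S, ∀ y ∈ S, ∀ t u : ℝ, 0 ≤ t → 0 ≤ u → t + u = 1 →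
    (t : EReal) * f x + (u : EReal) * f y ≤ f (t • x + u • y)

/-- Convexity on a set of an extended-real-valued function (used for values in `[-∞, ∞)`). -/
def ERealConvexOn {E : Type*} [AddCommGroup E] [Module ℝ E] (S : Set E) (f : E → EReal) : Prop :=
  Convex ℝ S ∧ ∀ x ∈ S, ∀ y ∈ S, ∀ t u : ℝ, 0 ≤ t → 0 ≤ u → t + u = 1 →
    f (t • x + u • y) ≤ (t : EReal) * f x + (u : EReal) * f y

end

/-! Everything is carried by the exponential of the objective, `objExp`, a continuous real function;
`elog` is monotone and returns to `[-∞, ∞)`. The constraints bound all entries of `(x, X)`, so the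
feasible region is compact and the maximum is attained.

(i) A binary `x` lifts to `(x, xxᵀ)`, where rows off the support become unit rows and the scaling
cancels, so the objectives agree.

(ii) The matrix inside the determinant is positive semidefinite (Schur product) and affine in `(x,
X)`, and `det` is log-concave (`rpow_det_mul_rpow_det_le`).

(iii) Expanding the determinant in principal minors makes `objExp` at fixed `(x, X)` a sum of
exponentials of linear forms in `log Υ` with nonnegative coefficients (`objExp_exp`). By Hölder its
logarithm is convex, and a supremum of convex functions is convex. -/

namespace BQPBound

open Matrix
open scoped MatrixOrder

/-! ### Extended logarithm and log-convexity of sums of exponentials -/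

/-- The logarithm extended by `-∞` on nonpositive reals. -/
noncomputable def elog (r : ℝ) : EReal := if 0 < r then ((Real.log r : ℝ) : EReal) else ⊥

theorem elog_of_pos {r : ℝ} (h : 0 < r) : elog r = ((Real.log r : ℝ) : EReal) := if_pos h

theorem elog_of_nonpos {r : ℝ} (h : r ≤ 0) : elog r = ⊥ := if_neg h.not_gt

theorem elog_mono : Monotone elog := by
  intro a b hab
  by_cases ha : 0 < a
  · rw [elog_of_pos ha, elog_of_pos (ha.trans_le hab)]
    exact_mod_cast Real.log_le_log ha hab
  · rw [elog_of_nonpos (not_lt.1 ha)]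
    exact bot_le

theorem elog_sub_coe (r c : ℝ) : elog r - (c : EReal) = elog (r * Real.exp (-c)) := by
  by_cases hr : 0 < r
  · rw [elog_of_pos hr, elog_of_pos (by positivity), Real.log_mul hr.ne' (Real.exp_ne_zero _),
      Real.log_exp]
    norm_cast
  · rw [elog_of_nonpos (not_lt.1 hr), elog_of_nonpos
      (mul_nonpos_of_nonpos_of_nonneg (not_lt.1 hr) (Real.exp_nonneg _))]
    simp [sub_eq_add_neg]

theorem elog_combo {a b t u : ℝ} (ha : 0 < a) (hb : 0 < b) :
    (t : EReal) * elog a + (u : EReal) * elog b = elog (a ^ t * b ^ u) := by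
  have h1 := Real.rpow_pos_of_pos ha t
  have h2 := Real.rpow_pos_of_pos hb u
  rw [elog_of_pos ha, elog_of_pos hb, elog_of_pos (mul_pos h1 h2), Real.log_mul h1.ne' h2.ne',
    Real.log_rpow ha, Real.log_rpow hb]
  norm_cast

/-- Strict weights are essential: `0 * ⊥ = 0` in `EReal`, so a zero weight would hide a value `⊥`.
-/
theorem combo_elog_le {a b c t u : ℝ} (ht : 0 < t) (hu : 0 < u)
    (h : 0 < a → 0 < b → a ^ t * b ^ u ≤ c) :
    (t : EReal) * elog a + (u : EReal) * elog b ≤ elog c := by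
  by_cases ha : 0 < a
  · by_cases hb : 0 < b
    · rw [elog_combo ha hb]
      exact elog_mono (h ha hb)
    · rw [elog_of_nonpos (not_lt.1 hb), EReal.coe_mul_bot_of_pos hu, EReal.add_bot]
      exact bot_le
  · rw [elog_of_nonpos (not_lt.1 ha), EReal.coe_mul_bot_of_pos ht, EReal.bot_add]
    exact bot_le

theorem elog_le_combo {a b c t u : ℝ} (h : 0 < c → 0 < a ∧ 0 < b ∧ c ≤ a ^ t * b ^ u) :
    elog c ≤ (t : EReal) * elog a + (u : EReal) * elog b := by
  by_cases hc : 0 < c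
  · obtain ⟨ha, hb, hle⟩ := h hc
    rw [elog_combo ha hb]
    exact elog_mono hle
  · rw [elog_of_nonpos (not_lt.1 hc)]
    exact bot_le

/-- Hölder's inequality for posynomials, in exponential coordinates. -/
theorem sum_mul_exp_combo_le {ι : Type*} (I : Finset ι) (a p q : ι → ℝ) (ha : ∀ i ∈ I, 0 ≤ a i)
    {t u : ℝ} (ht : 0 ≤ t) (hu : 0 ≤ u) (htu : t + u = 1)
    (hpos : 0 < ∑ i ∈ I, a i * Real.exp (t * p i + u * q i)) :
    0 < ∑ i ∈ I, a i * Real.exp (p i) ∧ 0 < ∑ i ∈ I, a i * Real.exp (q i) ∧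
    ∑ i ∈ I, a i * Real.exp (t * p i + u * q i) ≤
      (∑ i ∈ I, a i * Real.exp (p i)) ^ t * (∑ i ∈ I, a i * Real.exp (q i)) ^ u := by
  -- A positive sum has a term with positive coefficient, which forces the sums at `p` and `q` to be
  -- positive too.
  obtain ⟨j, hj, hjpos⟩ := Finset.exists_lt_of_sum_lt (s := I) (f := fun _ => (0 : ℝ))
    (g := fun i => a i * Real.exp (t * p i + u * q i)) (by simpa using hpos)
  have haj : 0 < a j := pos_of_mul_pos_left hjpos (Real.exp_nonneg _)
  have key : ∀ r : ι → ℝ, 0 < ∑ i ∈ I, a i * Real.exp (r i) := fun r =>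
    Finset.sum_pos' (fun i hi => mul_nonneg (ha i hi) (Real.exp_nonneg _))
      ⟨j, hj, mul_pos haj (Real.exp_pos _)⟩
  refine ⟨key p, key q, ?_⟩
  set P := ∑ i ∈ I, a i * Real.exp (p i) with hP
  set Q := ∑ i ∈ I, a i * Real.exp (q i) with hQ
  have hPp : 0 < P := key p
  have hQp : 0 < Q := key q
  -- Weighted AM-GM for the exponentials normalised by `P` and `Q`; after summation the bracket
  -- becomes `t + u = 1`.
  have hterm : ∀ i ∈ I, a i * Real.exp (t * p i + u * q i) ≤
      (P ^ t * Q ^ u) * (t * (a i * Real.exp (p i)) / P + u * (a i * Real.exp (q i)) / Q) := by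
    intro i hi
    have h := Real.geom_mean_le_arith_mean2_weighted ht hu
      (div_nonneg (Real.exp_nonneg (p i)) hPp.le) (div_nonneg (Real.exp_nonneg (q i)) hQp.le) htu
    rw [Real.div_rpow (Real.exp_nonneg _) hPp.le, Real.div_rpow (Real.exp_nonneg _) hQp.le,
      ← Real.exp_mul, ← Real.exp_mul, div_mul_div_comm, ← Real.exp_add, div_le_iff₀
      (mul_pos (Real.rpow_pos_of_pos hPp t) (Real.rpow_pos_of_pos hQp u))] at h
    calc a i * Real.exp (t * p i + u * q i)
        = a i * Real.exp (p i * t + q i * u) := by ring_nf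
      _ ≤ a i * ((t * (Real.exp (p i) / P) + u * (Real.exp (q i) / Q)) * (P ^ t * Q ^ u)) :=
        mul_le_mul_of_nonneg_left h (ha i hi)
      _ = _ := by ring
  calc _ ≤ ∑ i ∈ I, (P ^ t * Q ^ u) *
        (t * (a i * Real.exp (p i)) / P + u * (a i * Real.exp (q i)) / Q) :=
      Finset.sum_le_sum hterm
    _ = (P ^ t * Q ^ u) * (t * P / P + u * Q / Q) := by
      rw [← Finset.mul_sum, Finset.sum_add_distrib, ← Finset.sum_div, ← Finset.sum_div,
        ← Finset.mul_sum, ← Finset.mul_sum]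
    _ = P ^ t * Q ^ u := by
      rw [mul_div_cancel_right₀ _ hPp.ne', mul_div_cancel_right₀ _ hQp.ne', htu, mul_one]

/-! ### Determinants: principal minor expansion and log-concavity -/

section Det

variable {ι : Type*} [Fintype ι] [DecidableEq ι]

theorem diagonal_mul_mul_diagonal_apply (v : ι → ℝ) (N : Matrix ι ι ℝ) (i j : ι) :
    (diagonal v * N * diagonal v) i j = v i * N i j * v j := by
  rw [mul_diagonal, diagonal_mul]

/-- If the rows of `M` outside `S` are multiples `dᵢ eᵢ` of the unit vectors, the determinant is a
principal minor times a product. -/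
theorem det_of_rows_eq_single (M : Matrix ι ι ℝ) (S : Finset ι) (d : ι → ℝ)
    (h : ∀ i, i ∉ S → ∀ j, M i j = diagonal d i j) :
    M.det = (M.submatrix (fun i : S => (i : ι)) (fun i : S => (i : ι))).det *
      ∏ i ∈ Sᶜ, d i := by
  rw [twoBlockTriangular_det M (fun i => i ∈ S)]
  · have h2 : (toSquareBlockProp M fun i => ¬ i ∈ S) =
        diagonal (fun i : {i // ¬ i ∈ S} => d i) := by
      ext i j
      rw [toSquareBlockProp_def, of_apply, h _ i.2, diagonal_apply, diagonal_apply]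
      simp only [Subtype.ext_iff]
    rw [h2, det_diagonal]
    rw [Finset.prod_subtype (Sᶜ) (p := fun i => ¬ i ∈ S) (by simp)]
    congr 1
    rw [toSquareBlockProp]
    convert rfl using 2
    rfl
  · intro i hi j hj
    rw [h i hi, diagonal_apply_ne]
    rintro rfl
    exact hi hj

theorem det_principal_conj_diagonal (v : ι → ℝ) (N : Matrix ι ι ℝ) (S : Finset ι) :
    ((diagonal v * N * diagonal v).submatrix (fun i : S => (i : ι)) (fun i : S => (i : ι))).det =
      (N.submatrix (fun i : S => (i : ι)) (fun i : S => (i : ι))).det * ∏ i ∈ S, v i ^ 2 := by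
  have : (diagonal v * N * diagonal v).submatrix (fun i : S => (i : ι)) (fun i : S => (i : ι)) =
      diagonal (fun i : S => v i) *
        N.submatrix (fun i : S => (i : ι)) (fun i : S => (i : ι)) *
        diagonal (fun i : S => v i) := by
    ext i j
    rw [submatrix_apply, diagonal_mul_mul_diagonal_apply, diagonal_mul_mul_diagonal_apply,
      submatrix_apply]
  rw [this, det_mul, det_mul, det_diagonal, Finset.prod_coe_sort S v, Finset.prod_pow]
  ring

/-- Expansion of `det (N + diag d)` in principal minors, with a diagonal scaling of `N`. -/
theorem det_conj_diagonal_add_diagonal (v d : ι → ℝ) (N : Matrix ι ι ℝ) :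
    (diagonal v * N * diagonal v + diagonal d).det =
      ∑ S : Finset ι, (N.submatrix (fun i : S => (i : ι)) (fun i : S => (i : ι))).det *
        (∏ i ∈ S, v i ^ 2) * ∏ i ∈ Sᶜ, d i := by
  -- Multilinearity in the rows: `S` records which rows come from the scaled `N`, the others being
  -- diagonal.
  have h := (detRowAlternating (R := ℝ) (n := ι)).map_add_univ
    (diagonal v * N * diagonal v) (diagonal d)
  refine Eq.trans h (Finset.sum_congr rfl fun S _ => ?_)
  rw [← det_principal_conj_diagonal]
  refine (det_of_rows_eq_single (S.piecewise (diagonal v * N * diagonal v) (diagonal d)) S d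
    fun i hi j => ?_).trans ?_
  · exact congrFun (Finset.piecewise_eq_of_notMem S _ _ hi) j
  · congr 2
    ext i j
    exact congrFun (Finset.piecewise_eq_of_mem S (diagonal v * N * diagonal v).row
      (diagonal d).row i.2) (j : ι)

/-- Diagonalising `K` reduces this to `λ ^ u ≤ t + u * λ` for each eigenvalue, which is weighted
AM-GM for `1` and `λ`. -/
theorem rpow_det_le_det_combo_one {K : Matrix ι ι ℝ} (hK : K.PosDef) {t u : ℝ} (ht : 0 ≤ t)
    (hu : 0 ≤ u) (htu : t + u = 1) : K.det ^ u ≤ (t • (1 : Matrix ι ι ℝ) + u • K).det := by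
  have hH := hK.isHermitian
  have hdet : (t • (1 : Matrix ι ι ℝ) + u • K).det = ∏ i, (t + u * hH.eigenvalues i) := by
    set U : Matrix ι ι ℝ := (hH.eigenvectorUnitary : Matrix ι ι ℝ)
    have hU : U * star U = 1 := Unitary.coe_mul_star_self hH.eigenvectorUnitary
    have hspec : K = U * diagonal hH.eigenvalues * star U := by
      have := hH.spectral_theorem
      rw [Unitary.conjStarAlgAut_apply] at this
      exact this
    have : t • (1 : Matrix ι ι ℝ) + u • K =
        U * diagonal (fun i => t + u * hH.eigenvalues i) * star U := by
      have hd : diagonal (fun i => t + u * hH.eigenvalues i) =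
          t • (1 : Matrix ι ι ℝ) + u • diagonal hH.eigenvalues := by
        ext i j
        by_cases hij : i = j
        · subst hij; simp
        · simp [hij]
      rw [hd, mul_add, add_mul, mul_smul_comm, mul_one, smul_mul_assoc, hU, mul_smul_comm,
        smul_mul_assoc, ← hspec]
    rw [this, det_mul_right_comm, hU, one_mul, det_diagonal]
  have hKdet : K.det = ∏ i, hH.eigenvalues i := by
    simpa using hH.det_eq_prod_eigenvalues
  rw [hdet, hKdet, ← Real.finsetProd_rpow _ _ fun i _ => (hK.eigenvalues_pos i).le]
  refine Finset.prod_le_prod (fun i _ => Real.rpow_nonneg (hK.eigenvalues_pos i).le _)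
    fun i _ => ?_
  have := Real.geom_mean_le_arith_mean2_weighted ht hu zero_le_one (hK.eigenvalues_pos i).le htu
  simpa using this

/-- The determinant is log-concave on positive definite matrices. -/
theorem rpow_det_mul_rpow_det_le {A B : Matrix ι ι ℝ} (hA : A.PosDef) (hB : B.PosDef) {t u : ℝ}
    (ht : 0 ≤ t) (hu : 0 ≤ u) (htu : t + u = 1) :
    A.det ^ t * B.det ^ u ≤ (t • A + u • B).det := by
  -- With `A = Rᴴ * R`, congruence by `R⁻¹` turns the pair `A, B` into `1, K`, and every determinant
  -- picks up the same factor `det A`.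
  obtain ⟨R, hR⟩ := CStarAlgebra.nonneg_iff_eq_star_mul_self.1 hA.posSemidef.nonneg
  have hAdet : A.det = R.det * R.det := by
    rw [hR, det_mul, star_eq_conjTranspose, det_conjTranspose, star_trivial]
  have hRdet : R.det ≠ 0 := by
    intro h0
    have := hA.det_pos
    rw [hAdet, h0] at this
    simp at this
  have hRu : IsUnit R.det := isUnit_iff_ne_zero.2 hRdet
  have hRi : R * R⁻¹ = 1 := mul_nonsing_inv R hRu
  have hRi' : R⁻¹ * R = 1 := nonsing_inv_mul R hRu
  set K := (R⁻¹)ᴴ * B * R⁻¹ with hKdef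
  have hB' : B = Rᴴ * K * R := by
    have h1 : Rᴴ * (R⁻¹)ᴴ = 1 := by rw [← conjTranspose_mul, hRi', conjTranspose_one]
    calc B = (Rᴴ * (R⁻¹)ᴴ) * B * (R⁻¹ * R) := by rw [h1, hRi', one_mul, mul_one]
      _ = _ := by simp only [hKdef, mul_assoc]
  have hK : K.PosDef := by
    refine (PosSemidef.posDef_iff_det_ne_zero (hB.posSemidef.conjTranspose_mul_mul_same _)).2 ?_
    intro h0
    have := hB.det_pos
    rw [hB', det_mul, det_mul, h0] at this
    simp at this
  have hBdet : B.det = A.det * K.det := by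
    rw [hAdet, hB', det_mul, det_mul, det_conjTranspose, star_trivial]
    ring
  have hcombo : t • A + u • B = Rᴴ * (t • (1 : Matrix ι ι ℝ) + u • K) * R := by
    rw [mul_add, add_mul, mul_smul_comm, mul_one, smul_mul_assoc, mul_smul_comm, smul_mul_assoc,
      ← hB', hR, star_eq_conjTranspose]
  have hApos := hA.det_pos
  calc A.det ^ t * B.det ^ u = A.det ^ (t + u) * K.det ^ u := by
        rw [hBdet, Real.mul_rpow hApos.le hK.det_pos.le, Real.rpow_add hApos]; ring
    _ = A.det * K.det ^ u := by rw [htu, Real.rpow_one]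
    _ ≤ A.det * (t • (1 : Matrix ι ι ℝ) + u • K).det :=
      mul_le_mul_of_nonneg_left (rpow_det_le_det_combo_one hK ht hu htu) hApos.le
    _ = _ := by
      rw [hcombo, det_mul, det_mul, det_conjTranspose, star_trivial, hAdet]; ring

end Det

/-! ### Convexity and compactness of the feasible region -/

section Feasible

variable {m n : ℕ} {s : ℕ} {A : Matrix (Fin m) (Fin n) ℝ} {b : Fin m → ℝ}

theorem posSemidef_vecMulVec_self (x : Fin n → ℝ) : (vecMulVec x x).PosSemidef := by
  simpa using posSemidef_vecMulVec_self_star x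

theorem posSemidef_of_mem_bqpP {p : (Fin n → ℝ) × Matrix (Fin n) (Fin n) ℝ}
    (hp : p ∈ bqpP n s) : p.2.PosSemidef := by
  simpa using hp.2.1.add (posSemidef_vecMulVec_self p.1)

/-- The diagonal of `X - xxᵀ` has entries `xᵢ - xᵢ² ≥ 0`. -/
theorem mem_Icc_of_mem_bqpP {p : (Fin n → ℝ) × Matrix (Fin n) (Fin n) ℝ}
    (hp : p ∈ bqpP n s) (i : Fin n) : p.1 i ∈ Set.Icc (0 : ℝ) 1 := by
  have h := hp.2.1.diag_nonneg (i := i)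
  have hd : p.2 i i = p.1 i := congrFun hp.2.2.1 i
  rw [Matrix.sub_apply, vecMulVec_apply, hd] at h
  constructor <;> nlinarith

/-- Testing `X ⪰ 0` on `eᵢ ± eⱼ` gives `2|Xᵢⱼ| ≤ xᵢ + xⱼ ≤ 2`. -/
theorem entry_mem_Icc_of_mem_bqpP {p : (Fin n → ℝ) × Matrix (Fin n) (Fin n) ℝ}
    (hp : p ∈ bqpP n s) (i j : Fin n) : p.2 i j ∈ Set.Icc (-1 : ℝ) 1 := by
  have hX := posSemidef_of_mem_bqpP hp
  have hdi : p.2 i i = p.1 i := congrFun hp.2.2.1 i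
  have hdj : p.2 j j = p.1 j := congrFun hp.2.2.1 j
  have hsym : p.2 j i = p.2 i j := hp.1.apply i j
  have hi := mem_Icc_of_mem_bqpP hp i
  have hj := mem_Icc_of_mem_bqpP hp j
  have key : ∀ c : ℝ, 0 ≤ p.2 i i + c * p.2 i j + c * p.2 j i + c * c * p.2 j j := by
    intro c
    have h := hX.dotProduct_mulVec_nonneg (Pi.single i 1 + Pi.single j c)
    simp only [star_trivial, mulVec_add, mulVec_single, dotProduct_add, add_dotProduct,
      single_dotProduct, Pi.smul_apply, col_apply, MulOpposite.smul_eq_mul_unop,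
      MulOpposite.unop_op] at h
    linarith
  have h1 := key 1
  have h2 := key (-1)
  rw [hdi, hdj, hsym] at h1 h2
  constructor <;> linarith [hi.2, hj.2]

theorem convex_bqpFeasible : Convex ℝ (bqpFeasible s A b) := by
  rintro ⟨x, X⟩ ⟨⟨h1, h2, h3, h4, h5⟩, h6⟩ ⟨y, Y⟩ ⟨⟨k1, k2, k3, k4, k5⟩, k6⟩ t u ht hu htu
  simp only at h1 h2 h3 h4 h5 h6 k1 k2 k3 k4 k5 k6
  refine ⟨⟨?_, ?_, ?_, ?_, ?_⟩, ?_⟩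
  · exact (h1.smul t).add (k1.smul u)
  -- The constraint is quadratic in `x`; the defect is the positive semidefinite term `tu (x - y)(x
  -- - y)ᵀ`.
  · have : t • X + u • Y - vecMulVec (t • x + u • y) (t • x + u • y) =
        t • (X - vecMulVec x x) + u • (Y - vecMulVec y y) +
          (t * u) • vecMulVec (x - y) (x - y) := by
      obtain rfl : u = 1 - t := by linarith
      ext i j
      simp [vecMulVec_apply]
      ring
    simp only [Prod.smul_mk, Prod.mk_add_mk]
    rw [this]
    exact ((h2.smul ht).add (k2.smul hu)).add
      ((posSemidef_vecMulVec_self _).smul (mul_nonneg ht hu))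
  · simp only [Prod.smul_mk, Prod.mk_add_mk, diag_add, diag_smul, h3, k3]
  · simp only [Prod.smul_mk, Prod.mk_add_mk, Pi.add_apply, Pi.smul_apply, smul_eq_mul,
      Finset.sum_add_distrib, ← Finset.mul_sum, h4, k4]
    rw [← add_mul, htu, one_mul]
  · simp only [Prod.smul_mk, Prod.mk_add_mk, add_mulVec, smul_mulVec, h5, k5, smul_add]
    rw [smul_comm t, smul_comm u]
  · simp only [Prod.smul_mk, Prod.mk_add_mk, mulVec_add, mulVec_smul]
    calc t • A *ᵥ x + u • A *ᵥ y ≤ t • b + u • b :=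
          add_le_add (smul_le_smul_of_nonneg_left h6 ht) (smul_le_smul_of_nonneg_left k6 hu)
      _ = b := by rw [← add_smul, htu, one_smul]

theorem isClosed_setOf_posSemidef {ι : Type*} [Fintype ι] :
    IsClosed {M : Matrix ι ι ℝ | M.PosSemidef} := by
  have : {M : Matrix ι ι ℝ | M.PosSemidef} =
      {M | Mᴴ = M} ∩ ⋂ v : ι → ℝ, {M | 0 ≤ star v ⬝ᵥ (M *ᵥ v)} := by
    ext M
    simp [posSemidef_iff_dotProduct_mulVec, IsHermitian]
  rw [this]
  refine (isClosed_eq (by fun_prop) (by fun_prop)).inter (isClosed_iInter fun v => ?_)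
  exact isClosed_le (by fun_prop) (by fun_prop)

theorem isClosed_bqpFeasible : IsClosed (bqpFeasible s A b) := by
  have h1 : IsClosed {p : (Fin n → ℝ) × Matrix (Fin n) (Fin n) ℝ | p.2.IsSymm} :=
    isClosed_eq (by fun_prop) (by fun_prop)
  have h2 : IsClosed {p : (Fin n → ℝ) × Matrix (Fin n) (Fin n) ℝ |
      (p.2 - vecMulVec p.1 p.1).PosSemidef} :=
    isClosed_setOf_posSemidef.preimage
      (f := fun p : (Fin n → ℝ) × Matrix (Fin n) (Fin n) ℝ => p.2 - vecMulVec p.1 p.1)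
      (by fun_prop)
  have h3 : IsClosed {p : (Fin n → ℝ) × Matrix (Fin n) (Fin n) ℝ | p.2.diag = p.1} :=
    isClosed_eq (by fun_prop) (by fun_prop)
  have h4 : IsClosed {p : (Fin n → ℝ) × Matrix (Fin n) (Fin n) ℝ | ∑ i, p.1 i = (s : ℝ)} :=
    isClosed_eq (by fun_prop) (by fun_prop)
  have h5 : IsClosed {p : (Fin n → ℝ) × Matrix (Fin n) (Fin n) ℝ |
      p.2 *ᵥ (fun _ => 1) = (s : ℝ) • p.1} :=
    isClosed_eq (by fun_prop) (by fun_prop)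
  have h6 : IsClosed {p : (Fin n → ℝ) × Matrix (Fin n) (Fin n) ℝ | A *ᵥ p.1 ≤ b} :=
    isClosed_le (by fun_prop) (by fun_prop)
  exact (h1.inter (h2.inter (h3.inter (h4.inter h5)))).inter h6

theorem isCompact_bqpFeasible : IsCompact (bqpFeasible s A b) := by
  have hx : IsCompact (Set.univ.pi fun _ : Fin n => Set.Icc (0 : ℝ) 1) :=
    isCompact_univ_pi fun _ => isCompact_Icc
  have hX : IsCompact (X := Matrix (Fin n) (Fin n) ℝ)
      (Set.univ.pi fun _ : Fin n => Set.univ.pi fun _ : Fin n => Set.Icc (-1 : ℝ) 1) :=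
    isCompact_univ_pi fun _ => isCompact_univ_pi fun _ => isCompact_Icc
  refine (hx.prod hX).of_isClosed_subset isClosed_bqpFeasible fun p hp => ⟨?_, ?_⟩
  · exact fun i _ => mem_Icc_of_mem_bqpP hp.1 i
  · exact fun i _ j _ => entry_mem_Icc_of_mem_bqpP hp.1 i j

end Feasible

/-! ### The objective and the bound -/

section Objective

variable {m n : ℕ} {s : ℕ} {A : Matrix (Fin m) (Fin n) ℝ} {b : Fin m → ℝ}

/-- The matrix whose determinant appears in the BQP objective. -/
noncomputable def objMatrix (C : Matrix (Fin n) (Fin n) ℝ) (γ : Fin n → ℝ)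
    (p : (Fin n → ℝ) × Matrix (Fin n) (Fin n) ℝ) : Matrix (Fin n) (Fin n) ℝ :=
  hadamard (diagonal γ * C * diagonal γ) p.2 + diagonal (fun i => 1 - p.1 i)

/-- The exponential of the BQP objective. -/
noncomputable def objExp (C : Matrix (Fin n) (Fin n) ℝ) (γ : Fin n → ℝ)
    (p : (Fin n → ℝ) × Matrix (Fin n) (Fin n) ℝ) : ℝ :=
  (objMatrix C γ p).det * Real.exp (-(2 * ∑ i, p.1 i * Real.log (γ i)))

theorem bqpObjective_eq_elog (C : Matrix (Fin n) (Fin n) ℝ) (γ : Fin n → ℝ)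
    (p : (Fin n → ℝ) × Matrix (Fin n) (Fin n) ℝ) :
    bqpObjective C γ p = elog (objExp C γ p) :=
  elog_sub_coe _ _

theorem continuous_objExp (C : Matrix (Fin n) (Fin n) ℝ) (γ : Fin n → ℝ) :
    Continuous (objExp C γ) := by
  have h : Continuous (objMatrix C γ) := by
    refine continuous_matrix fun i j => ?_
    simp only [objMatrix, Matrix.add_apply, hadamard_apply, diagonal_apply]
    refine Continuous.add (by fun_prop) ?_
    split_ifs <;> fun_prop
  unfold objExp
  exact h.matrix_det.mul (by fun_prop)

theorem posSemidef_objMatrix {C : Matrix (Fin n) (Fin n) ℝ} (hC : C.PosSemidef) (γ : Fin n → ℝ)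
    {p : (Fin n → ℝ) × Matrix (Fin n) (Fin n) ℝ} (hp : p ∈ bqpP n s) :
    (objMatrix C γ p).PosSemidef := by
  refine PosSemidef.add (PosSemidef.hadamard ?_ (posSemidef_of_mem_bqpP hp))
    (PosSemidef.diagonal fun i => sub_nonneg.2 (mem_Icc_of_mem_bqpP hp i).2)
  simpa using hC.conjTranspose_mul_mul_same (diagonal γ)

theorem isGreatest_bqpBound (C : Matrix (Fin n) (Fin n) ℝ) (γ : Fin n → ℝ)
    (h : (bqpFeasible s A b).Nonempty) :
    IsGreatest (bqpObjective C γ '' bqpFeasible s A b) (bqpBound C s A b γ) := by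
  obtain ⟨p, hp, hmax⟩ := isCompact_bqpFeasible.exists_isMaxOn h
    (continuous_objExp C γ).continuousOn
  have hg : IsGreatest (bqpObjective C γ '' bqpFeasible s A b) (bqpObjective C γ p) := by
    refine ⟨⟨p, hp, rfl⟩, ?_⟩
    rintro _ ⟨q, hq, rfl⟩
    rw [bqpObjective_eq_elog, bqpObjective_eq_elog]
    exact elog_mono (hmax hq)
  rwa [bqpBound, hg.isLUB.sSup_eq]

theorem mem_bqpFeasible_of_mem_cmespFeasible {x : Fin n → ℝ} (hx : x ∈ cmespFeasible s A b) :
    (x, vecMulVec x x) ∈ bqpFeasible s A b := by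
  obtain ⟨h1, h2, h3⟩ := hx
  refine ⟨⟨?_, ?_, ?_, h1, ?_⟩, h3⟩
  · exact transpose_vecMulVec x x
  · simpa using PosSemidef.zero
  · ext i
    rcases h2 i with h | h <;> simp [vecMulVec_apply, h]
  · ext i
    simp [mulVec, dotProduct, vecMulVec_apply, ← Finset.mul_sum, h1, mul_comm]

/-- Rows off the support are unit rows, leaving the scaled minor on the support; its factor `∏ γᵢ²`
is cancelled by the term `-2 ∑ xᵢ log γᵢ`. -/
theorem bqpObjective_vecMulVec (C : Matrix (Fin n) (Fin n) ℝ) {γ : Fin n → ℝ}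
    (hγ : ∀ i, 0 < γ i) {x : Fin n → ℝ} (hx : ∀ i, x i = 0 ∨ x i = 1) :
    bqpObjective C γ (x, vecMulVec x x) = ldet (principalSubmatrix C (supp x)) := by
  have hmem : ∀ i, i ∈ supp x ↔ x i = 1 := fun i => by
    rcases hx i with h | h <;> simp [supp, h]
  have hnot : ∀ i, i ∉ supp x → x i = 0 := fun i hi => by
    rcases hx i with h | h
    · exact h
    · exact absurd ((hmem i).2 h) hi
  have hdet : (objMatrix C γ (x, vecMulVec x x)).det =
      (principalSubmatrix C (supp x)).det * ∏ i ∈ supp x, γ i ^ 2 := by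
    rw [det_of_rows_eq_single _ (supp x) (fun i => 1 - x i)]
    · rw [Finset.prod_eq_one, mul_one, principalSubmatrix, ← det_principal_conj_diagonal]
      · congr 1
        ext i j
        have hi := (hmem i).1 i.2
        have hj := (hmem j).1 j.2
        simp [objMatrix, vecMulVec_apply, diagonal_apply, hi, hj]
      · intro i hi
        simp [hnot i (Finset.mem_compl.1 hi)]
    · intro i hi j
      simp [objMatrix, vecMulVec_apply, hnot i hi]
  have hexp : Real.exp (2 * ∑ i, x i * Real.log (γ i)) = ∏ i ∈ supp x, γ i ^ 2 := by
    have : ∑ i, x i * Real.log (γ i) = ∑ i ∈ supp x, Real.log (γ i) := by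
      rw [← Finset.sum_subset (Finset.subset_univ (supp x))
        fun i _ hi => by rw [hnot i hi, zero_mul]]
      exact Finset.sum_congr rfl fun i hi => by rw [(hmem i).1 hi, one_mul]
    rw [this, Finset.mul_sum, Real.exp_sum]
    refine Finset.prod_congr rfl fun i _ => ?_
    rw [two_mul, Real.exp_add, Real.exp_log (hγ i), sq]
  rw [bqpObjective_eq_elog, objExp, hdet, Real.exp_neg]
  simp only [hexp]
  rw [mul_inv_cancel_right₀ (Finset.prod_ne_zero_iff.2 fun i _ => pow_ne_zero 2 (hγ i).ne')]
  rfl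

theorem cmespValue_le_bqpBound (C : Matrix (Fin n) (Fin n) ℝ) {γ : Fin n → ℝ}
    (hγ : ∀ i, 0 < γ i) : cmespValue C s A b ≤ bqpBound C s A b γ := by
  refine sSup_le ?_
  rintro _ ⟨x, hx, rfl⟩
  exact le_sSup ⟨_, mem_bqpFeasible_of_mem_cmespFeasible hx, bqpObjective_vecMulVec C hγ hx.2.1⟩

theorem objMatrix_combo (C : Matrix (Fin n) (Fin n) ℝ) (γ : Fin n → ℝ)
    (p q : (Fin n → ℝ) × Matrix (Fin n) (Fin n) ℝ) {t u : ℝ} (htu : t + u = 1) :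
    objMatrix C γ (t • p + u • q) = t • objMatrix C γ p + u • objMatrix C γ q := by
  obtain rfl : u = 1 - t := by linarith
  ext i j
  by_cases hij : i = j
  · subst hij
    simp [objMatrix]
    ring
  · simp [objMatrix, hij]
    ring

theorem concaveOn_bqpObjective {C : Matrix (Fin n) (Fin n) ℝ} (hC : C.PosSemidef)
    (γ : Fin n → ℝ) : ERealConcaveOn (bqpFeasible s A b) (bqpObjective C γ) := by
  refine ⟨convex_bqpFeasible, fun p hp q hq t u ht hu htu => ?_⟩
  -- Zero weights are treated apart, because `0 * ⊥ = 0`.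
  rcases ht.eq_or_lt with rfl | ht'
  · obtain rfl : u = 1 := by linarith
    simp
  rcases hu.eq_or_lt with rfl | hu'
  · obtain rfl : t = 1 := by linarith
    simp
  simp only [bqpObjective_eq_elog]
  refine combo_elog_le ht' hu' fun hp0 hq0 => ?_
  -- A positive semidefinite matrix with nonzero determinant is positive definite, so log-concavity
  -- of `det` applies.
  have hdp : 0 < (objMatrix C γ p).det := pos_of_mul_pos_left hp0 (Real.exp_nonneg _)
  have hdq : 0 < (objMatrix C γ q).det := pos_of_mul_pos_left hq0 (Real.exp_nonneg _)
  have h := rpow_det_mul_rpow_det_le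
    ((posSemidef_objMatrix hC γ hp.1).posDef_iff_det_ne_zero.2 hdp.ne')
    ((posSemidef_objMatrix hC γ hq.1).posDef_iff_det_ne_zero.2 hdq.ne') ht hu htu
  rw [← objMatrix_combo C γ p q htu] at h
  have hsum : -(2 * ∑ i, (t • p + u • q).1 i * Real.log (γ i)) =
      -(2 * ∑ i, p.1 i * Real.log (γ i)) * t + -(2 * ∑ i, q.1 i * Real.log (γ i)) * u := by
    simp only [Prod.fst_add, Prod.smul_fst, Pi.add_apply, Pi.smul_apply, smul_eq_mul, add_mul,
      Finset.sum_add_distrib, mul_assoc, ← Finset.mul_sum]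
    ring
  unfold objExp
  rw [hsum, Real.exp_add, Real.exp_mul, Real.exp_mul, Real.mul_rpow hdp.le (Real.exp_nonneg _),
    Real.mul_rpow hdq.le (Real.exp_nonneg _), mul_mul_mul_comm]
  exact mul_le_mul_of_nonneg_right h (by positivity)

/-- In logarithmic coordinates, the exponential of the objective is a posynomial. -/
theorem objExp_exp (C : Matrix (Fin n) (Fin n) ℝ) (η : Fin n → ℝ)
    (p : (Fin n → ℝ) × Matrix (Fin n) (Fin n) ℝ) :
    objExp C (fun i => Real.exp (η i)) p =
      ∑ S : Finset (Fin n), (((hadamard C p.2).submatrix (fun i : S => (i : Fin n))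
        (fun i : S => (i : Fin n))).det * ∏ i ∈ Sᶜ, (1 - p.1 i)) *
        Real.exp (2 * (∑ i ∈ S, η i - ∑ i, p.1 i * η i)) := by
  have hM : objMatrix C (fun i => Real.exp (η i)) p =
      diagonal (fun i => Real.exp (η i)) * hadamard C p.2 * diagonal (fun i => Real.exp (η i)) +
        diagonal (fun i => 1 - p.1 i) := by
    unfold objMatrix
    congr 1
    ext i j
    rw [hadamard_apply, diagonal_mul_mul_diagonal_apply, diagonal_mul_mul_diagonal_apply,
      hadamard_apply]
    ring
  rw [objExp, hM, det_conj_diagonal_add_diagonal, Finset.sum_mul]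
  refine Finset.sum_congr rfl fun S _ => ?_
  have h1 : ∏ i ∈ S, Real.exp (η i) ^ 2 = Real.exp (2 * ∑ i ∈ S, η i) := by
    rw [Finset.prod_pow, ← Real.exp_sum, sq, ← Real.exp_add, two_mul]
  rw [mul_sub, sub_eq_add_neg, Real.exp_add, h1]
  simp only [Real.log_exp]
  ring

theorem bqpObjective_exp_combo_le {C : Matrix (Fin n) (Fin n) ℝ} (hC : C.PosSemidef)
    {p : (Fin n → ℝ) × Matrix (Fin n) (Fin n) ℝ} (hp : p ∈ bqpP n s) (η θ : Fin n → ℝ) {t u : ℝ}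
    (ht : 0 ≤ t) (hu : 0 ≤ u) (htu : t + u = 1) :
    bqpObjective C (fun i => Real.exp ((t • η + u • θ) i)) p ≤
      (t : EReal) * bqpObjective C (fun i => Real.exp (η i)) p +
        (u : EReal) * bqpObjective C (fun i => Real.exp (θ i)) p := by
  simp only [bqpObjective_eq_elog]
  refine elog_le_combo ?_
  rw [objExp_exp, objExp_exp, objExp_exp]
  have hlin : ∀ S : Finset (Fin n),
      2 * (∑ i ∈ S, (t • η + u • θ) i - ∑ i, p.1 i * (t • η + u • θ) i) =
        t * (2 * (∑ i ∈ S, η i - ∑ i, p.1 i * η i)) +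
          u * (2 * (∑ i ∈ S, θ i - ∑ i, p.1 i * θ i)) := by
    intro S
    simp only [Pi.add_apply, Pi.smul_apply, smul_eq_mul, mul_add, Finset.sum_add_distrib,
      mul_left_comm _ t, mul_left_comm _ u, ← Finset.mul_sum]
    ring
  simp only [hlin]
  -- The coefficients are nonnegative: principal minors of `C ∘ X ⪰ 0` times products of `1 - xᵢ ≥
  -- 0`.
  refine sum_mul_exp_combo_le _ _ _ _ (fun S _ => mul_nonneg ?_ ?_) ht hu htu
  · exact ((hC.hadamard (posSemidef_of_mem_bqpP hp)).submatrix _).det_nonneg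
  · exact Finset.prod_nonneg fun i _ => sub_nonneg.2 (mem_Icc_of_mem_bqpP hp i).2

theorem convexOn_bqpBound_exp {C : Matrix (Fin n) (Fin n) ℝ} (hC : C.PosSemidef) :
    ERealConvexOn Set.univ
      (fun η : Fin n → ℝ => bqpBound C s A b (fun i => Real.exp (η i))) := by
  refine ⟨convex_univ, fun η _ θ _ t u ht hu htu => sSup_le ?_⟩
  rintro _ ⟨p, hp, rfl⟩
  refine (bqpObjective_exp_combo_le hC hp.1 η θ ht hu htu).trans (add_le_add ?_ ?_)
  · exact mul_le_mul_of_nonneg_left (le_sSup ⟨p, hp, rfl⟩) (EReal.coe_nonneg.2 ht)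
  · exact mul_le_mul_of_nonneg_left (le_sSup ⟨p, hp, rfl⟩) (EReal.coe_nonneg.2 hu)

end Objective

end BQPBound

theorem theorem1 {m n : ℕ} (s : ℕ) (hs : 0 < s) (hsn : s < n)
    (C : Matrix (Fin n) (Fin n) ℝ) (hC : C.PosSemidef) (hrank : s ≤ C.rank)
    (A : Matrix (Fin m) (Fin n) ℝ) (b : Fin m → ℝ) :
    -- the supremum defining the bound is a maximum
    (∀ γ : Fin n → ℝ, (∀ i, 0 < γ i) → (bqpFeasible s A b).Nonempty →
      IsGreatest (bqpObjective C γ '' bqpFeasible s A b) (bqpBound C s A b γ)) ∧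
    -- (i) upper bound
    (∀ γ : Fin n → ℝ, (∀ i, 0 < γ i) → cmespValue C s A b ≤ bqpBound C s A b γ) ∧
    -- (ii) concavity of the objective on the feasible region
    (∀ γ : Fin n → ℝ, (∀ i, 0 < γ i) →
      ERealConcaveOn (bqpFeasible s A b) (bqpObjective C γ)) ∧
    -- (iii) convexity of the bound in the logarithm of the scaling vector
    ERealConvexOn Set.univ
      (fun η : Fin n → ℝ => bqpBound C s A b (fun i => Real.exp (η i))) := ⟨fun γ _ h => BQPBound.isGreatest_bqpBound C γ h,
    fun _ hγ => BQPBound.cmespValue_le_bqpBound C hγ,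
    fun γ _ => BQPBound.concaveOn_bqpObjective hC γ,
    BQPBound.convexOn_bqpBound_exp hC⟩
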